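/- Let $p$ be a prime. Let $\mathcal G$ be a finite directed graph with vertex set $V$ whose edges carry labels from a finite alphabet $\mathcal A$ (formally, the edge set is a subset of $V\times V\times\mathcal A$, so loops, and several edges between the same vertices with different labels, are allowed), let $v_0\in V$, and let $\bar f_p:\mathcal A\to\{0,1,\dots,p-1\}$ be a digit assignment map. Let $X_{\mathcal G}(v_0)\subset\mathcal A^{\mathbb N}$ be the set of label sequences of all one-sided infinite walks in $\mathcal G$ starting at $v_0$, let $f_p:\mathcal A^{\mathbb N}\to\mathbb Z_p$ be the map $f_p(a_0,a_1,\dots)=\sum_{k\ge 0}\bar f_p(a_k)p^k$, and suppose that $Y=f_p(X_{\mathcal G}(v_0))\subset\mathbb Z_p$ is nonempty. Suppose that $(\bar f_p,\mathcal G,v_0)$ is a standard presentation of $Y$, that is: $\bar f_p$ is injective; at each vertex of $\mathcal G$ all exiting edges have different labels; and every vertex of $\mathcal G$ can be reached from $v_0$ by a directed path. Then the Hausdorff dimension of $Y$ with respect to the $p$-adic metric is $$d_H(Y)=\log_p\sigma(A)=\frac{\log\sigma(A)}{\log p},$$ where $\sigma(A)$ is the spectral radius of the adjacency matrix $A=[a_{i,j}]_{i,j\in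 V}$ of $\mathcal G$, in which $a_{i,j}$ is the number of directed edges from vertex $i$ to vertex $j$. -/

import Mathlib

open scoped ENNReal

/-- An edge-labeled directed graph on the vertex set `V` with labels in the alphabet `A`:
the edge `(i, j, a)` runs from `i` to `j` and carries the label `a`. Loops are allowed, and so
are several edges from `i` to `j` with different labels. -/
structure LabeledDigraph (V A : Type*) where
  edges : Set (V × V × A)

namespace LabeledDigraph

variable {V A : Type*}

/-- The path set `X_G(v)`: the label sequences of all one-sided infinite walks issuing
from `v`. -/
def pathSet (G : LabeledDigraph V A) (v : V) : Set (ℕ → A) :=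
  {a | ∃ w : ℕ → V, w 0 = v ∧ ∀ n, (w n, w (n + 1), a n) ∈ G.edges}

/-- At each vertex, all exiting edges have different labels. -/
def RightResolving (G : LabeledDigraph V A) : Prop :=
  ∀ (i j k : V) (a : A), (i, j, a) ∈ G.edges → (i, k, a) ∈ G.edges → j = k

/-- Every vertex can be reached from `v` by a directed path (possibly of length zero). -/
def Reachable (G : LabeledDigraph V A) (v : V) : Prop :=
  ∀ w : V, Relation.ReflTransGen (fun i j => ∃ a, (i, j, a) ∈ G.edges) v w

/-- The adjacency matrix of the underlying directed graph: its `(i, j)` entry counts the directed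
edges from `i` to `j`. -/
noncomputable def adjMatrix (G : LabeledDigraph V A) : Matrix V V ℕ :=
  Matrix.of fun i j => {a : A | (i, j, a) ∈ G.edges}.ncard

end LabeledDigraph

/-- The map `A^ℕ → ℤ_p` induced by a digit assignment map `f : A → {0, …, p - 1}`: it sends
`(a₀, a₁, …)` to the `p`-adic integer `∑ f(a_k) p^k`. -/
noncomputable def digitExpansion (p : ℕ) [Fact p.Prime] {A : Type*} (f : A → Fin p)
    (a : ℕ → A) : ℤ_[p] :=
  ∑' k, ((f (a k) : ℕ) : ℤ_[p]) * (p : ℤ_[p]) ^ k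

/-- The series defining `digitExpansion` always converges. -/
theorem summable_digitExpansion (p : ℕ) [Fact p.Prime] {A : Type*} (f : A → Fin p)
    (a : ℕ → A) : Summable fun k => ((f (a k) : ℕ) : ℤ_[p]) * (p : ℤ_[p]) ^ k := by
  have hp : (1 : ℝ) < p := by exact_mod_cast (Fact.out : p.Prime).one_lt
  refine Summable.of_norm_bounded (g := fun k : ℕ => ((p : ℝ)⁻¹) ^ k)
    (summable_geometric_of_lt_one (by positivity) (inv_lt_one_of_one_lt₀ hp)) fun k => ?_
  rw [norm_mul, norm_pow, PadicInt.norm_p]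
  exact mul_le_of_le_one_left (by positivity) (PadicInt.norm_le_one _)

/-- `(f, G, v)` is a presentation of `Y ⊆ ℤ_p`, that is, `Y` is the image of the path set `X_G(v)`,
and this presentation is standard: injective, right-resolving and reachable. -/
structure IsStandardPresentation (p : ℕ) [Fact p.Prime] {V A : Type*} (Y : Set ℤ_[p])
    (f : A → Fin p) (G : LabeledDigraph V A) (v : V) : Prop where
  eq_image : Y = digitExpansion p f '' G.pathSet v
  injective : Function.Injective f
  rightResolving : G.RightResolving
  reachable : G.Reachable v

/-!
Sequences agreeing in their first `n` letters go to `p`-adic integers at distance at most `p⁻ⁿ`, and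
conversely, so coverings of `Y` by balls are coverings of the path set by cylinders.

For the upper bound, the words of length `n` that begin a walk from `v` are at most as many as the
walks of length `n`, i.e. the `v`-th row sum of `Aⁿ`, which by Gelfand's formula is eventually at
most `rⁿ` for each `r > σ(A)`.

For the lower bound, the moduli of an eigenvector for an eigenvalue of maximal modulus give a
nonzero `x ≥ 0` with `σ(A) x ≤ A x`; no Perron vector is needed. If the cylinders of a covering,
weighted by `σ⁻ⁿ max x`, had total weight less than `x v`, then a greedy walk from `v`, always
moving to a vertex `w` where `x w` exceeds the suitably rescaled weight of the cylinders still
possible, would escape all of them. So the image of the path set of a vertex with `x v ≠ 0` has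
positive Hausdorff measure. Prepending a digit is antilipschitz, so reachability passes the
resulting bound on the dimension to `v₀`.
-/

open Filter MeasureTheory PiNat
open scoped NNReal

section SequenceCoding

variable {A : Type*}

/-- The words of length `n` that begin a sequence of `X`. As in `PiNat.res`, a word is stored with
its last letter first. -/
def prefixes (X : Set (ℕ → A)) (n : ℕ) : Set (List A) :=
  (fun a => res a n) '' X

theorem rpow_pow_comm (x : ℝ≥0∞) (y : ℝ) (n : ℕ) : (x ^ y) ^ n = (x ^ n) ^ y := by
  rw [← ENNReal.rpow_mul_natCast, mul_comm, ENNReal.rpow_natCast_mul]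

theorem exists_rpow_eq {b y : ℝ≥0∞} (hb1 : 1 < b) (hbt : b ≠ ∞) (hy1 : 1 ≤ y) (hyt : y ≠ ∞) :
    ∃ s : ℝ≥0, b ^ (s : ℝ) = y := by
  lift b to ℝ≥0 using hbt
  lift y to ℝ≥0 using hyt
  norm_cast at hb1 hy1
  refine ⟨⟨Real.logb b y, Real.logb_nonneg hb1 hy1⟩, ?_⟩
  rw [← ENNReal.coe_rpow_of_ne_zero (zero_lt_one.trans hb1).ne', ENNReal.coe_inj]
  exact NNReal.eq (Real.rpow_logb (zero_lt_one.trans hb1) (by exact_mod_cast hb1.ne')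
    (zero_lt_one.trans_le hy1))

theorem exists_le_pow_and_rpow_pow_le {q δ ε : ℝ≥0∞} {s : ℝ} (hq0 : q ≠ 0) (hq1 : q < 1)
    (hs : 0 < s) (hδ : δ ≤ 1) (hε : ε ≠ 0) :
    ∃ n : ℕ, δ ≤ q ^ n ∧ (q ^ s) ^ n ≤ (q ^ s)⁻¹ * δ ^ s + ε := by
  have hτ0 : q ^ s ≠ 0 := (ENNReal.rpow_pos (pos_iff_ne_zero.2 hq0) hq1.ne_top).ne'
  have hτ1 : q ^ s < 1 := ENNReal.rpow_lt_one hq1 hs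
  by_cases h : ∀ n : ℕ, δ ≤ q ^ n
  · obtain ⟨n, hn⟩ := ((ENNReal.tendsto_pow_atTop_nhds_zero_of_lt_one hτ1).eventually_lt_const
      (pos_iff_ne_zero.2 hε)).exists
    exact ⟨n, h n, hn.le.trans le_add_self⟩
  · push Not at h
    obtain ⟨n, hn, hn'⟩ := Nat.exists_not_and_succ_of_not_zero_of_exists
      (p := fun n => q ^ n < δ) (by simpa using hδ) h
    refine ⟨n, not_lt.1 hn, le_add_right ?_⟩
    calc (q ^ s) ^ n = (q ^ s)⁻¹ * (q ^ s) ^ (n + 1) := by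
          rw [pow_succ', ← mul_assoc, ENNReal.inv_mul_cancel hτ0 hτ1.ne_top, one_mul]
      _ = (q ^ s)⁻¹ * (q ^ (n + 1)) ^ s := by rw [rpow_pow_comm]
      _ ≤ (q ^ s)⁻¹ * δ ^ s := by gcongr

variable {E : Type*} {g : (ℕ → A) → E} {q : ℝ≥0∞} {X : Set (ℕ → A)} {s : ℝ}

theorem exists_preimage_subset_cylinder [PseudoEMetricSpace E] [Nonempty A]
    (hg : ∀ a b n, edist (g a) (g b) ≤ q ^ n → res a n = res b n)
    {t : Set E} {n : ℕ} (ht : Metric.ediam t ≤ q ^ n) :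
    ∃ z : ℕ → A, g ⁻¹' t ⊆ cylinder z n := by
  obtain h | ⟨z, hz⟩ := (g ⁻¹' t).eq_empty_or_nonempty
  · exact ⟨Classical.arbitrary _, h ▸ Set.empty_subset _⟩
  · refine ⟨z, fun a ha => ?_⟩
    rw [cylinder_eq_res]
    exact hg _ _ _ ((Metric.edist_le_ediam_of_mem (s := t) ha hz).trans ht)

theorem le_tsum_ediam_rpow_of_forall_cylinder_cover [PseudoEMetricSpace E] [Nonempty A]
    {κ : ℝ≥0∞} (hq0 : q ≠ 0) (hq1 : q < 1) (hs : 0 < s)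
    (hg : ∀ a b n, edist (g a) (g b) ≤ q ^ n → res a n = res b n)
    (hX : ∀ (z : ℕ → ℕ → A) (n : ℕ → ℕ), X ⊆ ⋃ i, cylinder (z i) (n i) →
      κ ≤ ∑' i, (q ^ s) ^ n i)
    {t : ℕ → Set E} (hcov : g '' X ⊆ ⋃ i, t i) (ht : ∀ i, Metric.ediam (t i) ≤ 1) :
    κ ≤ (q ^ s)⁻¹ * ∑' i, Metric.ediam (t i) ^ s := by
  refine ENNReal.le_of_forall_pos_le_add fun ε hε _ => ?_
  obtain ⟨η, hη0, hη⟩ :=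
    ENNReal.exists_pos_sum_of_countable' (ENNReal.coe_ne_zero.2 hε.ne') ℕ
  choose n hn hnη using fun i =>
    exists_le_pow_and_rpow_pow_le hq0 hq1 hs (ht i) (hη0 i).ne'
  choose z hz using fun i => exists_preimage_subset_cylinder hg (hn i)
  have hXz : X ⊆ ⋃ i, cylinder (z i) (n i) := by
    refine (Set.image_subset_iff.1 hcov).trans ?_
    rw [Set.preimage_iUnion]
    exact Set.iUnion_mono hz
  calc κ ≤ ∑' i, (q ^ s) ^ n i := hX z n hXz
    _ ≤ ∑' i, ((q ^ s)⁻¹ * Metric.ediam (t i) ^ s + η i) := ENNReal.tsum_le_tsum hnη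
    _ = (q ^ s)⁻¹ * ∑' i, Metric.ediam (t i) ^ s + ∑' i, η i := by
        rw [ENNReal.tsum_add, ENNReal.tsum_mul_left]
    _ ≤ (q ^ s)⁻¹ * ∑' i, Metric.ediam (t i) ^ s + ε := by gcongr

variable [EMetricSpace E] [MeasurableSpace E] [BorelSpace E]

theorem le_hausdorffMeasure_image_of_forall_cylinder_cover [Nonempty A] {κ : ℝ≥0∞}
    (hq0 : q ≠ 0) (hq1 : q < 1) (hs : 0 < s)
    (hg : ∀ a b n, edist (g a) (g b) ≤ q ^ n → res a n = res b n)
    (hX : ∀ (z : ℕ → ℕ → A) (n : ℕ → ℕ), X ⊆ ⋃ i, cylinder (z i) (n i) →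
      κ ≤ ∑' i, (q ^ s) ^ n i) :
    κ ≤ (q ^ s)⁻¹ * μH[s] (g '' X) := by
  have hτ0 : q ^ s ≠ 0 := (ENNReal.rpow_pos (pos_iff_ne_zero.2 hq0) hq1.ne_top).ne'
  have hτt : q ^ s ≠ ∞ := (ENNReal.rpow_lt_one hq1 hs).ne_top
  rw [mul_comm, ← div_eq_mul_inv, ENNReal.le_div_iff_mul_le (.inl hτ0) (.inl hτt),
    Measure.hausdorffMeasure_apply]
  refine le_iSup₂_of_le 1 one_pos (le_iInf fun t => le_iInf fun hcov => le_iInf fun ht => ?_)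
  rw [← ENNReal.le_div_iff_mul_le (.inl hτ0) (.inl hτt), div_eq_mul_inv, mul_comm]
  refine (le_tsum_ediam_rpow_of_forall_cylinder_cover hq0 hq1 hs hg hX hcov ht).trans ?_
  gcongr with i
  obtain h | h := (t i).eq_empty_or_nonempty
  · simp [h, hs]
  · simp [h]

theorem hausdorffMeasure_image_eq_zero [Countable A] {r : ℝ≥0∞} (hq1 : q < 1) (hs : 0 ≤ s)
    (hg : ∀ a b n, res a n = res b n → edist (g a) (g b) ≤ q ^ n)
    (hX : ∀ᶠ n in atTop, ((prefixes X n).encard : ℝ≥0∞) ≤ r ^ n) (hr : r * q ^ s < 1) :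
    μH[s] (g '' X) = 0 := by
  let t (n : ℕ) (u : prefixes X n) : Set E := g '' {a | res a n = u}
  have hdiam (n : ℕ) (u : prefixes X n) : Metric.ediam (t n u) ≤ q ^ n := by
    refine Metric.ediam_le ?_
    rintro _ ⟨a, ha, rfl⟩ _ ⟨b, hb, rfl⟩
    exact hg a b n (Eq.trans ha (Eq.symm hb))
  have hcov (n : ℕ) : g '' X ⊆ ⋃ u, t n u := by
    rintro _ ⟨a, ha, rfl⟩
    exact Set.mem_iUnion.2 ⟨⟨_, a, ha, rfl⟩, a, rfl, rfl⟩
  have hsum : ∀ᶠ n in atTop, ∑' u, Metric.ediam (t n u) ^ s ≤ (r * q ^ s) ^ n := by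
    filter_upwards [hX] with n hn
    calc ∑' u, Metric.ediam (t n u) ^ s ≤ ∑' _ : prefixes X n, (q ^ n) ^ s :=
          ENNReal.tsum_le_tsum fun u => ENNReal.rpow_le_rpow (hdiam n u) hs
      _ = (prefixes X n).encard * (q ^ n) ^ s := ENNReal.tsum_set_const _ _
      _ ≤ r ^ n * (q ^ s) ^ n := by rw [rpow_pow_comm]; gcongr
      _ = (r * q ^ s) ^ n := (mul_pow _ _ _).symm
  refine le_antisymm ?_ zero_le
  calc μH[s] (g '' X) ≤ liminf (fun n => ∑' u, Metric.ediam (t n u) ^ s) atTop :=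
        Measure.hausdorffMeasure_le_liminf_tsum s _ (fun n => q ^ n)
          (ENNReal.tendsto_pow_atTop_nhds_zero_of_lt_one hq1) t (.of_forall hdiam)
          (.of_forall hcov)
    _ ≤ liminf (fun n => (r * q ^ s) ^ n) atTop := liminf_le_liminf hsum
    _ = 0 := (ENNReal.tendsto_pow_atTop_nhds_zero_of_lt_one hr).liminf_eq

end SequenceCoding

section DigitExpansion

variable (p : ℕ) [Fact p.Prime] {A : Type*} (f : A → Fin p)

theorem digitExpansion_eq_add_p_mul (a : ℕ → A) :
    digitExpansion p f a =
      ((f (a 0) : ℕ) : ℤ_[p]) + p * digitExpansion p f (fun k => a (k + 1)) := by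
  unfold digitExpansion
  rw [(summable_digitExpansion p f a).tsum_eq_zero_add,
    ← (summable_digitExpansion p f fun k => a (k + 1)).tsum_mul_left]
  simp only [pow_zero, mul_one, pow_succ', mul_left_comm]

theorem edist_add_p_mul (c x y : ℤ_[p]) :
    edist (c + p * x) (c + p * y) = (p : ℝ≥0∞)⁻¹ * edist x y := by
  have hp : (p : ℝ≥0) ≠ 0 := Nat.cast_ne_zero.2 (Fact.out : p.Prime).ne_zero
  have hdist : nndist (c + p * x) (c + p * y) = (p : ℝ≥0)⁻¹ * nndist x y := by
    ext
    simp [dist_eq_norm, ← mul_sub]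
  rw [edist_nndist, edist_nndist, hdist, ENNReal.coe_mul, ENNReal.coe_inv hp, ENNReal.coe_natCast]

theorem antilipschitzWith_add_p_mul (c : ℤ_[p]) :
    AntilipschitzWith p fun x : ℤ_[p] => c + p * x := fun x y => by
  have hp : (p : ℝ≥0∞) ≠ 0 := Nat.cast_ne_zero.2 (Fact.out : p.Prime).ne_zero
  rw [edist_add_p_mul, ENNReal.coe_natCast, ← mul_assoc,
    ENNReal.mul_inv_cancel hp (ENNReal.natCast_ne_top p), one_mul]

theorem digit_eq_of_edist_lt_one {i j : Fin p} {x y : ℤ_[p]}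
    (h : edist (((i : ℕ) : ℤ_[p]) + p * x) (((j : ℕ) : ℤ_[p]) + p * y) < 1) : i = j := by
  have hdvd : (p : ℤ_[p]) ∣ ((i - j : ℤ) : ℤ_[p]) + p * (x - y) := by
    have hsub : ((i - j : ℤ) : ℤ_[p]) + p * (x - y) =
        ((i : ℕ) : ℤ_[p]) + p * x - (((j : ℕ) : ℤ_[p]) + p * y) := by
      push_cast
      ring
    rw [← ENNReal.ofReal_one, edist_lt_ofReal, dist_eq_norm] at h
    rwa [← PadicInt.norm_lt_one_iff_dvd, hsub]
  rw [dvd_add_left (dvd_mul_right _ _), ← PadicInt.norm_lt_one_iff_dvd,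
    PadicInt.norm_int_lt_one_iff_dvd] at hdvd
  have := Int.eq_zero_of_abs_lt_dvd hdvd (by rw [abs_lt]; omega)
  omega

theorem edist_digit_add_p_mul_le_iff {i j : Fin p} {x y : ℤ_[p]} {n : ℕ} :
    edist (((i : ℕ) : ℤ_[p]) + p * x) (((j : ℕ) : ℤ_[p]) + p * y) ≤ (p : ℝ≥0∞)⁻¹ ^ (n + 1) ↔
      i = j ∧ edist x y ≤ (p : ℝ≥0∞)⁻¹ ^ n := by
  have hp0 : (p : ℝ≥0∞)⁻¹ ≠ 0 := by simp
  have hp1 : (p : ℝ≥0∞)⁻¹ < 1 := by simpa using (Fact.out : p.Prime).one_lt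
  have hpow : (p : ℝ≥0∞)⁻¹ ^ (n + 1) < 1 := pow_lt_one₀ zero_le hp1 n.succ_ne_zero
  have key (k : Fin p) : edist (((k : ℕ) : ℤ_[p]) + p * x) (((k : ℕ) : ℤ_[p]) + p * y) ≤
      (p : ℝ≥0∞)⁻¹ ^ (n + 1) ↔ edist x y ≤ (p : ℝ≥0∞)⁻¹ ^ n := by
    rw [edist_add_p_mul, pow_succ', ENNReal.mul_le_mul_iff_right hp0 hp1.ne_top]
  constructor
  · intro h
    obtain rfl : i = j := digit_eq_of_edist_lt_one p (h.trans_lt hpow)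
    exact ⟨rfl, (key i).1 h⟩
  · rintro ⟨rfl, h⟩
    exact (key i).2 h

variable {f}

theorem edist_digitExpansion_le_of_res_eq {a b : ℕ → A} {n : ℕ} (h : res a n = res b n) :
    edist (digitExpansion p f a) (digitExpansion p f b) ≤ (p : ℝ≥0∞)⁻¹ ^ n := by
  rw [res_eq_res] at h
  induction n generalizing a b with
  | zero =>
    rw [pow_zero, ← ENNReal.ofReal_one, edist_le_ofReal zero_le_one, dist_eq_norm]
    exact PadicInt.norm_le_one _
  | succ n ih =>
    rw [digitExpansion_eq_add_p_mul p f a, digitExpansion_eq_add_p_mul p f b,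
      edist_digit_add_p_mul_le_iff]
    exact ⟨congrArg f (h n.succ_pos), ih fun k hk => h (Nat.succ_lt_succ hk)⟩

theorem res_eq_of_edist_digitExpansion_le (hf : Function.Injective f) {a b : ℕ → A} {n : ℕ}
    (h : edist (digitExpansion p f a) (digitExpansion p f b) ≤ (p : ℝ≥0∞)⁻¹ ^ n) :
    res a n = res b n := by
  rw [res_eq_res]
  induction n generalizing a b with
  | zero => simp
  | succ n ih =>
    rw [digitExpansion_eq_add_p_mul p f a, digitExpansion_eq_add_p_mul p f b,
      edist_digit_add_p_mul_le_iff] at h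
    rintro (_ | k) hk
    · exact hf h.1
    · exact ih h.2 (Nat.lt_of_succ_lt_succ hk)

end DigitExpansion

namespace LabeledDigraph

variable {V A : Type*} (G : LabeledDigraph V A)

theorem mem_pathSet_iff {v : V} {a : ℕ → A} :
    a ∈ G.pathSet v ↔ ∃ w, (v, w, a 0) ∈ G.edges ∧ (fun n => a (n + 1)) ∈ G.pathSet w := by
  constructor
  · rintro ⟨u, rfl, hu⟩
    exact ⟨u 1, hu 0, fun n => u (n + 1), rfl, fun n => hu (n + 1)⟩
  · rintro ⟨w, hw, u, rfl, hu⟩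
    exact ⟨fun n => Nat.casesOn n v u, rfl, fun n => Nat.casesOn n hw hu⟩

theorem exists_mem_pathSet_of_forall_extend {P : List A → V → Prop} {v : V} (hv : P [] v)
    (hP : ∀ u w, P u w → ∃ w' a, (w, w', a) ∈ G.edges ∧ P (a :: u) w') :
    ∃ a ∈ G.pathSet v, ∀ n, ∃ w, P (res a n) w := by
  let S := {s : List A × V // P s.1 s.2}
  have step (s : S) : ∃ (a : A) (s' : S), (s.1.2, s'.1.2, a) ∈ G.edges ∧ s'.1.1 = a :: s.1.1 := by
    obtain ⟨w', a, he, hP'⟩ := hP _ _ s.2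
    exact ⟨a, ⟨(a :: s.1.1, w'), hP'⟩, he, rfl⟩
  choose label next hedge hcons using step
  let state (n : ℕ) : S := next^[n] ⟨([], v), hv⟩
  have hnext (n : ℕ) : state (n + 1) = next (state n) := Function.iterate_succ_apply' ..
  have hres (n : ℕ) : res (fun k => label (state k)) n = (state n).1.1 := by
    induction n with
    | zero => rfl
    | succ n ih => rw [res_succ, ih, hnext, hcons]
  exact ⟨_, ⟨fun n => (state n).1.2, rfl, fun n => hnext n ▸ hedge (state n)⟩,
    fun n => ⟨_, hres n ▸ (state n).2⟩⟩

section Exits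

variable [Finite A]

/-- The edges leaving `v`, recorded as pairs of a target and a label. -/
noncomputable def exits [Finite V] (v : V) : Finset (V × A) :=
  (Set.toFinite {e | (v, e) ∈ G.edges}).toFinset

theorem mem_exits [Finite V] {v : V} {e : V × A} : e ∈ G.exits v ↔ (v, e) ∈ G.edges := by
  simp [exits]

theorem sum_exits [Fintype V] {M : Type*} [Semiring M] (v : V) (x : V → M) :
    ∑ e ∈ G.exits v, x e.1 = ∑ w, (G.adjMatrix v w : M) * x w := by
  classical
  have := Fintype.ofFinite A
  have hexits : G.exits v = Finset.univ.filter fun e => (v, e) ∈ G.edges := by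
    ext e
    simp [mem_exits]
  rw [hexits, Finset.sum_filter, Fintype.sum_prod_type]
  refine Finset.sum_congr rfl fun w _ => ?_
  dsimp only
  rw [← Finset.sum_filter, Finset.sum_const, nsmul_eq_mul]
  simp [adjMatrix, Set.ncard_eq_toFinset_card']

theorem prefixes_pathSet_succ_subset [Finite V] (v : V) (n : ℕ) :
    prefixes (G.pathSet v) (n + 1) ⊆
      ⋃ e ∈ G.exits v, (· ++ [e.2]) '' prefixes (G.pathSet e.1) n := by
  have res_succ_eq_append (a : ℕ → A) (n : ℕ) :
      res a (n + 1) = res (fun k => a (k + 1)) n ++ [a 0] := by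
    induction n with
    | zero => rfl
    | succ n ih => rw [res_succ, ih, res_succ, List.cons_append]
  rintro _ ⟨a, ha, rfl⟩
  obtain ⟨w, hw, ha'⟩ := G.mem_pathSet_iff.1 ha
  exact Set.mem_biUnion (G.mem_exits.2 hw) ⟨_, ⟨_, ha', rfl⟩, (res_succ_eq_append a n).symm⟩

theorem encard_prefixes_pathSet_le [Fintype V] [DecidableEq V] (v : V) (n : ℕ) :
    (prefixes (G.pathSet v) n).encard ≤ ∑ w, (G.adjMatrix ^ n) v w := by
  induction n generalizing v with
  | zero =>
    have hsub : prefixes (G.pathSet v) 0 ⊆ {[]} := by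
      rintro _ ⟨a, _, rfl⟩
      rfl
    simpa [Matrix.one_apply] using Set.encard_le_encard hsub
  | succ n ih =>
    calc (prefixes (G.pathSet v) (n + 1)).encard
        ≤ (⋃ e ∈ G.exits v, (· ++ [e.2]) '' prefixes (G.pathSet e.1) n).encard :=
          Set.encard_le_encard (G.prefixes_pathSet_succ_subset v n)
      _ ≤ ∑ e ∈ G.exits v, ((· ++ [e.2]) '' prefixes (G.pathSet e.1) n).encard :=
          Finset.set_encard_biUnion_le _ _
      _ ≤ ∑ e ∈ G.exits v, ((∑ w, (G.adjMatrix ^ n) e.1 w : ℕ) : ℕ∞) := by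
          gcongr with e
          exact (Set.encard_image_le _ _).trans (by exact_mod_cast ih e.1)
      _ = ((∑ w, (G.adjMatrix ^ (n + 1)) v w : ℕ) : ℕ∞) := by
          rw [G.sum_exits v fun u => ((∑ w, (G.adjMatrix ^ n) u w : ℕ) : ℕ∞), pow_succ']
          simp only [Matrix.mul_apply, Finset.mul_sum, Nat.cast_sum, Nat.cast_mul]
          exact Finset.sum_comm

end Exits

section CylinderCover

variable [Fintype V] [Finite A] {G} {σ : ℝ≥0∞} {x : V → ℝ≥0∞}

theorem exists_edge_lt (hG : G.RightResolving)
    (hx : ∀ v, σ * x v ≤ ∑ w, (G.adjMatrix v w : ℝ≥0∞) * x w) {v : V} {c : A → ℝ≥0∞}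
    (hc : ∑' a, c a < σ * x v) : ∃ w a, (v, w, a) ∈ G.edges ∧ c a < x w := by
  classical
  by_contra! hle
  refine (hc.trans_le (hx v)).not_ge ?_
  have hinj : Set.InjOn Prod.snd (G.exits v : Set (V × A)) := by
    rintro ⟨w, a⟩ hw ⟨w', _⟩ hw' rfl
    exact Prod.ext (hG _ _ _ _ (G.mem_exits.1 hw) (G.mem_exits.1 hw')) rfl
  calc ∑ w, (G.adjMatrix v w : ℝ≥0∞) * x w = ∑ e ∈ G.exits v, x e.1 := (G.sum_exits v x).symm
    _ ≤ ∑ e ∈ G.exits v, c e.2 := Finset.sum_le_sum fun e he => hle _ _ (G.mem_exits.1 he)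
    _ = ∑ a ∈ (G.exits v).image Prod.snd, c a := (Finset.sum_image hinj).symm
    _ ≤ ∑' a, c a := ENNReal.sum_le_tsum _

theorem exists_mem_pathSet_forall_weight_lt (hG : G.RightResolving) (hσ0 : σ ≠ 0) (hσt : σ ≠ ∞)
    (hx : ∀ v, σ * x v ≤ ∑ w, (G.adjMatrix v w : ℝ≥0∞) * x w) {m : List A → ℝ≥0∞}
    (hm : ∀ u, ∑' a, m (a :: u) ≤ m u) {v : V} (hv : m [] < x v) :
    ∃ a ∈ G.pathSet v, ∀ n, σ ^ n * m (res a n) < ⨆ w, x w := by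
  obtain ⟨a, ha, hlt⟩ := G.exists_mem_pathSet_of_forall_extend
    (P := fun u w => σ ^ u.length * m u < x w) (v := v) (by simpa using hv) fun u w huw => by
      refine exists_edge_lt hG hx ?_
      calc ∑' a, σ ^ (a :: u).length * m (a :: u) = σ * (σ ^ u.length * ∑' a, m (a :: u)) := by
            simp only [List.length_cons, ENNReal.tsum_mul_left, pow_succ', mul_assoc]
        _ ≤ σ * (σ ^ u.length * m u) := by gcongr; exact hm u
        _ < σ * x w := (ENNReal.mul_lt_mul_iff_right hσ0 hσt).2 huw
  refine ⟨a, ha, fun n => ?_⟩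
  obtain ⟨w, hw⟩ := hlt n
  rw [res_length] at hw
  exact hw.trans_le (le_iSup x w)

theorem le_iSup_mul_tsum_of_cylinder_cover (hG : G.RightResolving) (hσ0 : σ ≠ 0) (hσt : σ ≠ ∞)
    (hx : ∀ v, σ * x v ≤ ∑ w, (G.adjMatrix v w : ℝ≥0∞) * x w) {v : V} {ι : Type*}
    {z : ι → ℕ → A} {n : ι → ℕ} (hcov : G.pathSet v ⊆ ⋃ i, cylinder (z i) (n i)) :
    x v ≤ ∑' i, (⨆ w, x w) * σ⁻¹ ^ n i := by
  classical
  by_contra! hlt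
  -- the mass that `∑ i, c i • dirac (z i)` gives to the cylinder of the word `u`
  let c (i : ι) : ℝ≥0∞ := (⨆ w, x w) * σ⁻¹ ^ n i
  let m (u : List A) : ℝ≥0∞ := ∑' i, if res (z i) u.length = u then c i else 0
  have hm (u : List A) : ∑' a, m (a :: u) ≤ m u := by
    rw [ENNReal.tsum_comm]
    refine ENNReal.tsum_le_tsum fun i => ?_
    refine (tsum_eq_single (z i u.length) fun a ha =>
      if_neg fun h => ha (List.cons.inj h).1.symm).trans_le ?_
    simp
  obtain ⟨a, ha, hlt'⟩ :=
    exists_mem_pathSet_forall_weight_lt hG hσ0 hσt hx hm (v := v) (by simpa [m] using hlt)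
  obtain ⟨i, hi⟩ := Set.mem_iUnion.1 (hcov ha)
  rw [cylinder_eq_res] at hi
  refine (hlt' (n i)).not_ge ?_
  calc ⨆ w, x w = σ ^ n i * c i := by
        rw [mul_left_comm, ← mul_pow, ENNReal.mul_inv_cancel hσ0 hσt, one_pow, mul_one]
    _ = σ ^ n i * (if res (z i) (res a (n i)).length = res a (n i) then c i else 0) := by
        rw [res_length, if_pos (Eq.symm hi)]
    _ ≤ σ ^ n i * m (res a (n i)) := by
        gcongr
        exact ENNReal.le_tsum i

end CylinderCover

end LabeledDigraph

section Spectral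

attribute [local instance] Matrix.linftyOpNormedRing Matrix.linftyOpNormedAlgebra

variable {V : Type*} [Fintype V] [DecidableEq V] (C : Matrix V V ℂ)

theorem eventually_sum_nnnorm_pow_apply_le_pow {r : ℝ≥0∞} (hr : spectralRadius ℂ C < r) :
    ∀ᶠ n : ℕ in atTop, ∀ v, ((∑ w, ‖(C ^ n) v w‖₊ : ℝ≥0) : ℝ≥0∞) ≤ r ^ n := by
  have hgelfand := spectrum.pow_nnnorm_pow_one_div_tendsto_nhds_spectralRadius C
  filter_upwards [hgelfand.eventually_lt_const hr, eventually_gt_atTop 0] with n hn hn0 v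
  have hnorm : ∑ w, ‖(C ^ n) v w‖₊ ≤ ‖C ^ n‖₊ := by
    rw [Matrix.linfty_opNNNorm_def]
    exact Finset.le_sup (f := fun i => ∑ j, ‖(C ^ n) i j‖₊) (Finset.mem_univ v)
  calc ((∑ w, ‖(C ^ n) v w‖₊ : ℝ≥0) : ℝ≥0∞) ≤ ‖C ^ n‖₊ := ENNReal.coe_le_coe.2 hnorm
    _ = ((‖C ^ n‖₊ : ℝ≥0∞) ^ (1 / n : ℝ)) ^ n := by
        rw [one_div, ENNReal.rpow_inv_natCast_pow hn0.ne']
    _ ≤ r ^ n := by gcongr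

theorem matrix_spectralRadius_ne_top : spectralRadius ℂ C ≠ ∞ :=
  ne_top_of_le_ne_top (by simp [ENNReal.mul_eq_top])
    (spectrum.spectralRadius_le_pow_nnnorm_pow_one_div ℂ C 0)

theorem exists_spectralRadius_mul_le_sum_nnnorm_mul [Nonempty V] :
    ∃ x : V → ℝ≥0, x ≠ 0 ∧
      ∀ v, spectralRadius ℂ C * x v ≤ ((∑ w, ‖C v w‖₊ * x w : ℝ≥0) : ℝ≥0∞) := by
  obtain ⟨z, hz, hzr⟩ := spectrum.exists_nnnorm_eq_spectralRadius C
  rw [← Matrix.spectrum_toLin', ← Module.End.hasEigenvalue_iff_mem_spectrum] at hz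
  obtain ⟨y, hy⟩ := hz.exists_hasEigenvector
  refine ⟨fun v => ‖y v‖₊, fun h => hy.2 (funext fun v => by simpa using congrFun h v),
    fun v => ?_⟩
  have heig : ∑ w, C v w * y w = z * y v := congrFun hy.apply_eq_smul v
  rw [← hzr, ← ENNReal.coe_mul, ENNReal.coe_le_coe]
  calc ‖z‖₊ * ‖y v‖₊ = ‖∑ w, C v w * y w‖₊ := by rw [heig, nnnorm_mul]
    _ ≤ ∑ w, ‖C v w * y w‖₊ := nnnorm_sum_le _ _
    _ = ∑ w, ‖C v w‖₊ * ‖y w‖₊ := by simp only [nnnorm_mul]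

end Spectral

namespace LabeledDigraph

variable {V A : Type*} {G : LabeledDigraph V A}

section SpectralRadius

variable [Fintype V] [DecidableEq V] [Finite A]

theorem eventually_encard_prefixes_pathSet_le {r : ℝ≥0∞}
    (hr : spectralRadius ℂ (G.adjMatrix.map (Nat.cast : ℕ → ℂ)) < r) (v : V) :
    ∀ᶠ n in atTop, ((prefixes (G.pathSet v) n).encard : ℝ≥0∞) ≤ r ^ n := by
  filter_upwards [eventually_sum_nnnorm_pow_apply_le_pow _ hr] with n hn
  have hmap : G.adjMatrix.map (Nat.cast : ℕ → ℂ) ^ n = (G.adjMatrix ^ n).map Nat.cast :=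
    (map_pow (Nat.castRingHom ℂ).mapMatrix G.adjMatrix n).symm
  calc ((prefixes (G.pathSet v) n).encard : ℝ≥0∞) ≤ (∑ w, (G.adjMatrix ^ n) v w : ℕ) :=
        ENat.toENNReal_le.2 (G.encard_prefixes_pathSet_le v n)
    _ = (∑ w, ‖(G.adjMatrix.map (Nat.cast : ℕ → ℂ) ^ n) v w‖₊ : ℝ≥0) := by simp [hmap]
    _ ≤ r ^ n := hn v

theorem one_le_spectralRadius {v : V} (hv : (G.pathSet v).Nonempty) :
    1 ≤ spectralRadius ℂ (G.adjMatrix.map (Nat.cast : ℕ → ℂ)) := by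
  by_contra! hlt
  obtain ⟨r, hGr, hr1⟩ := exists_between hlt
  obtain ⟨n, hn, hn0⟩ :=
    ((eventually_encard_prefixes_pathSet_le hGr v).and (eventually_gt_atTop 0)).exists
  have hone : 1 ≤ (prefixes (G.pathSet v) n).encard :=
    Set.one_le_encard_iff_nonempty.2 (hv.image _)
  have hle : (1 : ℝ≥0∞) ≤ r ^ n := le_trans (by exact_mod_cast hone) hn
  exact hle.not_gt (pow_lt_one₀ zero_le hr1 hn0.ne')

end SpectralRadius

variable (p : ℕ) [Fact p.Prime] {f : A → Fin p}

theorem dimH_image_le_of_edge {v w : V} {a : A} (h : (v, w, a) ∈ G.edges) :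
    dimH (digitExpansion p f '' G.pathSet w) ≤ dimH (digitExpansion p f '' G.pathSet v) := by
  refine ((antilipschitzWith_add_p_mul p ((f a : ℕ) : ℤ_[p])).le_dimH_image _).trans (dimH_mono ?_)
  rintro _ ⟨_, ⟨b, hb, rfl⟩, rfl⟩
  refine ⟨fun n => Nat.casesOn n a b, G.mem_pathSet_iff.2 ⟨w, h, hb⟩, ?_⟩
  rw [digitExpansion_eq_add_p_mul]
  rfl

theorem Reachable.dimH_image_le {v : V} (h : G.Reachable v) (w : V) :
    dimH (digitExpansion p f '' G.pathSet w) ≤ dimH (digitExpansion p f '' G.pathSet v) := by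
  induction h w with
  | refl => exact le_rfl
  | tail _ hbc ih =>
    obtain ⟨a, ha⟩ := hbc
    exact (dimH_image_le_of_edge p ha).trans ih

theorem hausdorffMeasure_image_ne_zero [Fintype V] [Finite A] [MeasurableSpace ℤ_[p]]
    [BorelSpace ℤ_[p]] (hf : Function.Injective f) (hG : G.RightResolving) {s : ℝ} (hs : 0 < s)
    {x : V → ℝ≥0}
    (hx : ∀ v, (p : ℝ≥0∞) ^ s * x v ≤ ∑ w, (G.adjMatrix v w : ℝ≥0∞) * x w) {v : V}
    (hv : x v ≠ 0) : μH[s] (digitExpansion p f '' G.pathSet v) ≠ 0 := by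
  have hp0 : (p : ℝ≥0∞) ≠ 0 := Nat.cast_ne_zero.2 (Fact.out : p.Prime).ne_zero
  have hp1 : (p : ℝ≥0∞)⁻¹ < 1 := by simpa using (Fact.out : p.Prime).one_lt
  have hσ0 : (p : ℝ≥0∞) ^ s ≠ 0 := by simp [hp0]
  have hσt : (p : ℝ≥0∞) ^ s ≠ ∞ := ENNReal.rpow_ne_top_of_nonneg hs.le (ENNReal.natCast_ne_top p)
  have : Nonempty A := by
    obtain ⟨_, a, -⟩ := exists_edge_lt hG hx (c := 0) (v := v) (by simp [hv, hσ0, pos_iff_ne_zero])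
    exact ⟨a⟩
  set M : ℝ≥0∞ := ⨆ w, (x w : ℝ≥0∞) with hM
  have hMt : M ≠ ∞ := iSup_ne_top fun w => ENNReal.coe_ne_top
  have hM0 : M ≠ 0 := fun h => hv (by simpa [hM] using iSup_eq_bot.1 h v)
  have hle : x v / M ≤ ((p : ℝ≥0∞)⁻¹ ^ s)⁻¹ * μH[s] (digitExpansion p f '' G.pathSet v) := by
    refine le_hausdorffMeasure_image_of_forall_cylinder_cover (by simp) hp1 hs
      (fun _ _ _ => res_eq_of_edist_digitExpansion_le p hf) fun z n hcov => ?_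
    rw [ENNReal.div_le_iff hM0 hMt, mul_comm, ← ENNReal.tsum_mul_left, ENNReal.inv_rpow]
    exact le_iSup_mul_tsum_of_cylinder_cover hG hσ0 hσt hx hcov
  intro hzero
  rw [hzero, mul_zero] at hle
  simp [hv, hMt] at hle

variable [Fintype V] [DecidableEq V] [Finite A]

theorem dimH_image_le_of_spectralRadius_lt {s : ℝ≥0}
    (hs : spectralRadius ℂ (G.adjMatrix.map (Nat.cast : ℕ → ℂ)) < (p : ℝ≥0∞) ^ (s : ℝ)) (v : V) :
    dimH (digitExpansion p f '' G.pathSet v) ≤ s := by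
  borelize ℤ_[p]
  obtain ⟨r, hGr, hrs⟩ := exists_between hs
  have hp1 : (p : ℝ≥0∞)⁻¹ < 1 := by simpa using (Fact.out : p.Prime).one_lt
  have hr : r * (p : ℝ≥0∞)⁻¹ ^ (s : ℝ) < 1 := by
    rw [ENNReal.inv_rpow, ← div_eq_mul_inv]
    exact ENNReal.div_lt_of_lt_mul (by rwa [one_mul])
  have hzero : μH[s] (digitExpansion p f '' G.pathSet v) = 0 :=
    hausdorffMeasure_image_eq_zero hp1 s.2 (fun _ _ _ => edist_digitExpansion_le_of_res_eq p)
      (eventually_encard_prefixes_pathSet_le hGr v) hr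
  exact dimH_le_of_hausdorffMeasure_ne_top (hzero ▸ ENNReal.zero_ne_top)

theorem Reachable.le_dimH_image (hf : Function.Injective f) (hG : G.RightResolving)
    {v : V} (hv : G.Reachable v) {s : ℝ≥0}
    (hs : (p : ℝ≥0∞) ^ (s : ℝ) ≤ spectralRadius ℂ (G.adjMatrix.map (Nat.cast : ℕ → ℂ))) :
    s ≤ dimH (digitExpansion p f '' G.pathSet v) := by
  borelize ℤ_[p]
  obtain rfl | hs0 := eq_zero_or_pos s
  · simp
  have : Nonempty V := ⟨v⟩
  obtain ⟨x, hx0, hx⟩ :=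
    exists_spectralRadius_mul_le_sum_nnnorm_mul (G.adjMatrix.map (Nat.cast : ℕ → ℂ))
  obtain ⟨w, hw⟩ := Function.ne_iff.1 hx0
  have hmeas : μH[s] (digitExpansion p f '' G.pathSet w) ≠ 0 :=
    hausdorffMeasure_image_ne_zero p hf hG hs0
      (fun u => (mul_le_mul_left hs _).trans (by simpa using hx u)) hw
  exact (le_dimH_of_hausdorffMeasure_ne_zero hmeas).trans (hv.dimH_image_le p w)

theorem dimH_image_eq {v : V} (hf : Function.Injective f) (hG : G.RightResolving)
    (hv : G.Reachable v) {s : ℝ≥0}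
    (hs : (p : ℝ≥0∞) ^ (s : ℝ) = spectralRadius ℂ (G.adjMatrix.map (Nat.cast : ℕ → ℂ))) :
    dimH (digitExpansion p f '' G.pathSet v) = s := by
  refine le_antisymm (le_of_forall_gt fun c hc => ?_) (hv.le_dimH_image p hf hG hs.le)
  obtain ⟨t, hst, htc⟩ := ENNReal.lt_iff_exists_nnreal_btwn.1 hc
  refine (dimH_image_le_of_spectralRadius_lt p ?_ v).trans_lt htc
  rw [← hs]
  exact ENNReal.rpow_lt_rpow_of_exponent_lt (by exact_mod_cast (Fact.out : p.Prime).one_lt)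
    (ENNReal.natCast_ne_top p) (by exact_mod_cast hst)

end LabeledDigraph

theorem theorem1p1 (p : ℕ) [Fact p.Prime] {V A : Type*} [Fintype V] [DecidableEq V] [Finite A]
    (Y : Set ℤ_[p]) (hY : Y.Nonempty) (f : A → Fin p) (G : LabeledDigraph V A) (v₀ : V)
    (h : IsStandardPresentation p Y f G v₀) :
    ((dimH Y : ℝ≥0∞) : EReal) =
      ENNReal.log (spectralRadius ℂ (G.adjMatrix.map (Nat.cast : ℕ → ℂ))) /
        ((Real.log p : ℝ) : EReal) := by
  have hp : 1 < p := (Fact.out : p.Prime).one_lt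
  have hlog : 0 < Real.log p := Real.log_pos (by exact_mod_cast hp)
  obtain ⟨rfl, hf, hG, hv₀⟩ := h
  obtain ⟨s, hs⟩ := exists_rpow_eq (by exact_mod_cast hp) (ENNReal.natCast_ne_top p)
    (LabeledDigraph.one_le_spectralRadius hY.of_image) (matrix_spectralRadius_ne_top _)
  have hlogp : ENNReal.log p = (Real.log p : EReal) := by
    rw [ENNReal.log_pos_real (by exact_mod_cast (zero_lt_one.trans hp).ne')
      (ENNReal.natCast_ne_top p), ENNReal.toReal_natCast]
  rw [LabeledDigraph.dimH_image_eq p hf hG hv₀ hs, ← hs, ENNReal.log_rpow, hlogp, eq_comm,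
    EReal.div_eq_iff (EReal.coe_ne_bot _) (EReal.coe_ne_top _) (by exact_mod_cast hlog.ne')]
  rfl
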